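/- Let $\mathcal H$ be a complex Hilbert space and let $T,T'$ be contractions on $\mathcal H$. We say that $T$ is Harnack dominated by $T'$, written $T\stackrel{\rm H}{\prec}T'$, if there is a constant $c\ge 1$ such that $\Re p(T)\le c\,\Re p(T')$ for every polynomial $p\in\mathbb C[z]$ with $\Re p(z)\ge 0$ for all $|z|\le 1$, where $\Re A=\frac12(A+A^*)$; and that $T$ and $T'$ are Harnack equivalent if $T\stackrel{\rm H}{\prec}T'$ and $T'\stackrel{\rm H}{\prec}T$. Write $\mathcal N(A)$ for the kernel of $A$, $D_{T'}=(I-T'^*T')^{1/2}$, and $S_T$ for the strong limit of $(T^{*n}T^n)_{n}$. A closed subspace reduces $T$ if it is invariant for $T$ and $T^*$. Let $\mathcal H_i$ (respectively $\mathcal H_i'$) be the largest closed subspace reducing $T$ (respectively $T'$) on which $T$ (respectively $T'$) is an isometry. A minimal isometric dilation of $T$ is an isometry $V$ on a Hilbert space $\mathcal K\supset\mathcal H$ with $\mathcal K=\bigvee_{n\ge0}V^n\mathcal H$ and $P_{\mathcal H}V=TP_{\mathcal H}$. If $T\stackrel{\rm H}{\prec}T'$ and $V$ on $\mathcal K$,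 $V'$ on $\mathcal K'$ are minimal isometric dilations of $T$, $T'$, the Harnack operator associated to $(T,T')$ is the unique bounded operator $A:\mathcal K'\to\mathcal K$ with $A|_{\mathcal H}=I_{\mathcal H}$ and $AV'=VA$. **Theorem.** Suppose that $TT'=T'T$ and that $T\stackrel{\rm H}{\prec}T'$. Then: (i) $\mathcal H_i'\subset\mathcal H_i$ and $T'=T$ on $\mathcal H_i'$. (ii) If $\mathcal H_i\subset\mathcal N(D_{T'})$, then $\mathcal H_i'$ reduces $T$. If $\mathcal N(I-S_T)$ reduces $T'$, then $$\mathcal H_i=\mathcal H_i'=\mathcal N(I-S_{T'})=\mathcal N(I-S_T).$$ (iii) If the Harnack operator associated to $(T,T')$ is injective, then $\mathcal H_i'$ reduces $T$. (iv) If $T$ and $T'$ are Harnack equivalent, then $\mathcal H_i=\mathcal H_i'$. -/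

import Mathlib

open Filter Topology
open scoped InnerProduct ComplexStarModule

universe u v w

noncomputable section

namespace HarnackParts

section Operators

variable {H : Type u} [NormedAddCommGroup H] [InnerProductSpace ℂ H] [CompleteSpace H]

/-- `T` is Harnack dominated by `T'`: there is a constant `c ≥ 1` such that
`Re p(T) ≤ c Re p(T')` (Loewner order) for every analytic polynomial `p` with `Re p(z) ≥ 0`
on the closed unit disc. Here `ℜ A = (1/2)(A + A*)`. -/
def HarnackDominated (T T' : H →L[ℂ] H) : Prop :=
  ∃ c : ℝ, 1 ≤ c ∧ ∀ p : Polynomial ℂ, (∀ z : ℂ, ‖z‖ ≤ 1 → 0 ≤ (p.eval z).re) →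
    (ℜ (Polynomial.aeval T p) : H →L[ℂ] H) ≤ c • (ℜ (Polynomial.aeval T' p) : H →L[ℂ] H)

/-- `T` and `T'` are Harnack equivalent (belong to the same Harnack part). -/
def HarnackEquivalent (T T' : H →L[ℂ] H) : Prop :=
  HarnackDominated T T' ∧ HarnackDominated T' T

/-- The defect operator `D_T = (I - T* T)^{1/2}`. -/
def defect (T : H →L[ℂ] H) : H →L[ℂ] H :=
  CFC.sqrt (1 - T† * T)

/-- `S` is the strong limit of the sequence `T*ⁿ Tⁿ`. -/
def IsStrongLimit (T S : H →L[ℂ] H) : Prop :=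
  ∀ x : H, Tendsto (fun n : ℕ => ((T†) ^ n * T ^ n) x) atTop (𝓝 (S x))

open Classical in
/-- The asymptotic limit `S_T`, the strong limit of `T*ⁿ Tⁿ` (which exists for every
contraction, see `isStrongLimit_asymptoticLimit`; the value is `0` if there is no limit). -/
def asymptoticLimit (T : H →L[ℂ] H) : H →L[ℂ] H :=
  if h : ∃ S, IsStrongLimit T S then h.choose else 0

/-- A closed subspace `M` reduces `T` if it is invariant for `T` and for `T*`. -/
def Reduces (M : Submodule ℂ H) (T : H →L[ℂ] H) : Prop :=
  IsClosed (M : Set H) ∧ (∀ x ∈ M, T x ∈ M) ∧ ∀ x ∈ M, (T†) x ∈ M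

/-- `M` is a reducing subspace for `T` on which `T` is an isometry. -/
def IsReducingIsometric (T : H →L[ℂ] H) (M : Submodule ℂ H) : Prop :=
  Reduces M T ∧ ∀ x ∈ M, ‖T x‖ = ‖x‖

/-- The reducing isometric part of `T`: the closed linear span of all reducing subspaces on which
`T` is an isometry. By `isGreatest_reducingIsometricPart` it is the maximal (that is, the largest)
reducing subspace on which `T` is an isometry. -/
def reducingIsometricPart (T : H →L[ℂ] H) : Submodule ℂ H :=
  (sSup {M : Submodule ℂ H | IsReducingIsometric T M}).topologicalClosure

theorem isGreatest_reducingIsometricPart (T : H →L[ℂ] H) :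
    IsGreatest {M : Submodule ℂ H | IsReducingIsometric T M} (reducingIsometricPart T) := by
  have hmap : ∀ R : H →L[ℂ] H, (∀ M : Submodule ℂ H, IsReducingIsometric T M → ∀ x ∈ M, R x ∈ M) →
      ∀ x ∈ reducingIsometricPart T, R x ∈ reducingIsometricPart T := by
    intro R hR x hx
    have h1 : sSup {M : Submodule ℂ H | IsReducingIsometric T M} ≤
        (sSup {M : Submodule ℂ H | IsReducingIsometric T M}).comap (R : H →ₗ[ℂ] H) := by
      refine sSup_le fun M hM y hy => ?_
      exact (le_sSup (a := M) hM) (hR M hM y hy)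
    exact map_mem_closure R.continuous hx fun y hy => h1 hy
  have hker : reducingIsometricPart T ≤ LinearMap.ker ((1 - T† * T : H →L[ℂ] H) : H →ₗ[ℂ] H) := by
    refine Submodule.topologicalClosure_minimal _ (sSup_le fun M hM y hy => ?_)
      (ContinuousLinearMap.isClosed_ker (1 - T† * T : H →L[ℂ] H))
    obtain ⟨⟨-, h1, h2⟩, h3⟩ := hM
    have hz : y - (T†) (T y) ∈ M := M.sub_mem hy (h2 _ (h1 _ hy))
    have hin : ∀ a ∈ M, ∀ b ∈ M, inner ℂ (T a) (T b) = inner ℂ a b := by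
      intro a ha b hb
      let U : M →ₗᵢ[ℂ] H := ⟨(T : H →ₗ[ℂ] H).comp M.subtype, fun x => h3 x x.2⟩
      exact U.inner_map_map ⟨a, ha⟩ ⟨b, hb⟩
    have h0 : inner ℂ (y - (T†) (T y)) (y - (T†) (T y)) = (0 : ℂ) := by
      nth_rewrite 1 [inner_sub_left]
      rw [ContinuousLinearMap.adjoint_inner_left, hin _ hy _ hz, sub_self]
    have := inner_self_eq_zero.mp h0
    simpa using this
  refine ⟨⟨⟨Submodule.isClosed_topologicalClosure _, hmap T fun M hM => hM.1.2.1,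
    hmap (T†) fun M hM => hM.1.2.2⟩, fun x hx => ?_⟩, fun M hM => ?_⟩
  · have h1 : x - (T†) (T x) = 0 := by simpa using hker hx
    have h2 : (inner ℂ (T x) (T x) : ℂ) = inner ℂ x x := by
      rw [← ContinuousLinearMap.adjoint_inner_left, ← sub_eq_zero.mp h1]
    rw [inner_self_eq_norm_sq_to_K, inner_self_eq_norm_sq_to_K] at h2
    have h3 : ‖T x‖ ^ 2 = ‖x‖ ^ 2 := by exact_mod_cast h2
    exact (pow_left_inj₀ (norm_nonneg _) (norm_nonneg _) two_ne_zero).mp h3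
  · exact (le_sSup (a := M) hM).trans (Submodule.le_topologicalClosure _)

theorem exists_isStrongLimit {T : H →L[ℂ] H} (hT : ‖T‖ ≤ 1) : ∃ S, IsStrongLimit T S := by
  have hpow : ∀ (R : H →L[ℂ] H), ‖R‖ ≤ 1 → ∀ (n : ℕ) (x : H), ‖(R ^ n) x‖ ≤ ‖x‖ := by
    intro R hR n x
    induction n with
    | zero => simp
    | succ n ih =>
      rw [pow_succ', mul_apply_eq_comp]
      exact (R.le_of_opNorm_le hR _).trans (by simpa using ih)
  have hT' : ‖T†‖ ≤ 1 := by rwa [LinearIsometryEquiv.norm_map]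
  have hadj : ∀ n : ℕ, (T ^ n)† = (T†) ^ n := fun n => by
    rw [← ContinuousLinearMap.star_eq_adjoint, ← ContinuousLinearMap.star_eq_adjoint, star_pow]
  have key : ∀ (x : H) (n k : ℕ),
      ‖((T†) ^ (n + k) * T ^ (n + k)) x - ((T†) ^ n * T ^ n) x‖ ^ 2 ≤
        ‖(T ^ n) x‖ ^ 2 - ‖(T ^ (n + k)) x‖ ^ 2 := by
    intro x n k
    set y := (T ^ n) x with hy
    set z := (T ^ k) y with hz
    have e1 : (T ^ (n + k)) x = z := by
      rw [add_comm, pow_add, mul_apply_eq_comp]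
    have e2 : ((T†) ^ (n + k) * T ^ (n + k)) x - ((T†) ^ n * T ^ n) x
        = ((T†) ^ n) (((T†) ^ k) z - y) := by
      rw [mul_apply_eq_comp, e1, pow_add, mul_apply_eq_comp,
        mul_apply_eq_comp, map_sub]
    have e3 : RCLike.re (inner ℂ (((T†) ^ k) z) y) = ‖z‖ ^ 2 := by
      rw [← hadj, ContinuousLinearMap.adjoint_inner_left, ← hz, inner_self_eq_norm_sq]
    have e4 : ‖((T†) ^ k) z - y‖ ^ 2 ≤ ‖y‖ ^ 2 - ‖z‖ ^ 2 := by
      rw [@norm_sub_sq ℂ, e3]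
      have := pow_le_pow_left₀ (norm_nonneg _) (hpow _ hT' k z) 2
      linarith
    rw [e1, e2]
    exact (pow_le_pow_left₀ (norm_nonneg _) (hpow _ hT' n _) 2).trans e4
  have hex : ∀ x : H, ∃ y, Tendsto (fun n : ℕ => ((T†) ^ n * T ^ n) x) atTop (𝓝 y) := by
    intro x
    have hanti : Antitone fun n : ℕ => ‖(T ^ n) x‖ ^ 2 := by
      refine antitone_nat_of_succ_le fun n => ?_
      have := (sq_nonneg _).trans (key x n 1)
      linarith
    have hconv : CauchySeq fun n : ℕ => ‖(T ^ n) x‖ ^ 2 :=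
      (tendsto_atTop_ciInf hanti ⟨0, by rintro _ ⟨n, rfl⟩; positivity⟩).cauchySeq
    refine cauchySeq_tendsto_of_complete (Metric.cauchySeq_iff'.mpr fun ε hε => ?_)
    obtain ⟨N, hN⟩ := Metric.cauchySeq_iff'.mp hconv (ε ^ 2) (by positivity)
    refine ⟨N, fun n hn => ?_⟩
    obtain ⟨k, rfl⟩ := Nat.exists_eq_add_of_le hn
    have h1 := hN (N + k) hn
    rw [Real.dist_eq, abs_sub_comm] at h1
    have h2 := (key x N k).trans_lt ((le_abs_self _).trans_lt h1)
    rw [dist_eq_norm]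
    exact lt_of_pow_lt_pow_left₀ 2 hε.le h2
  choose f hf using hex
  exact ⟨continuousLinearMapOfTendsto (fun n : ℕ => (T†) ^ n * T ^ n)
    (tendsto_pi_nhds.mpr hf), hf⟩

theorem isStrongLimit_asymptoticLimit {T : H →L[ℂ] H} (hT : ‖T‖ ≤ 1) :
    IsStrongLimit T (asymptoticLimit T) := by
  have h := exists_isStrongLimit hT
  rw [asymptoticLimit, dif_pos h]
  exact h.choose_spec

/-- The kernel `N(A)` of a bounded operator. -/
abbrev kernel (A : H →L[ℂ] H) : Submodule ℂ H := LinearMap.ker (A : H →ₗ[ℂ] H)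

end Operators

section Dilations

variable {H : Type u} [NormedAddCommGroup H] [InnerProductSpace ℂ H] [CompleteSpace H]
variable {K : Type v} [NormedAddCommGroup K] [InnerProductSpace ℂ K] [CompleteSpace K]
variable {K' : Type w} [NormedAddCommGroup K'] [InnerProductSpace ℂ K'] [CompleteSpace K']

/-- `V`, acting on the Hilbert space `K` that contains `H` through the isometric embedding `ι`, is
a minimal isometric dilation of `T`: `V` is an isometry, `K` is the closed linear span of the
subspaces `Vⁿ H`, and `P V = T P`, where `P = ι*` is the orthogonal projection of `K` onto `H`. -/
structure IsMinimalIsometricDilation (T : H →L[ℂ] H) (ι : H →ₗᵢ[ℂ] K) (V : K →L[ℂ] K) : Prop where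
  isometry : ∀ x, ‖V x‖ = ‖x‖
  minimal : (Submodule.span ℂ {x : K | ∃ (n : ℕ) (h : H), x = (V ^ n) (ι h)}).topologicalClosure = ⊤
  dilation : (ι.toContinuousLinearMap)† ∘L V = T ∘L (ι.toContinuousLinearMap)†

/-- `A : K' → K` is the Harnack operator of the pair whose minimal isometric dilations are
`(ι, V)` on `K` and `(ι', V')` on `K'`: a bounded operator that is the identity on `H`
and satisfies `A V' = V A`. By minimality of `V'` there is at most one. -/
def IsHarnackOperator (ι : H →ₗᵢ[ℂ] K) (V : K →L[ℂ] K) (ι' : H →ₗᵢ[ℂ] K') (V' : K' →L[ℂ] K')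
    (A : K' →L[ℂ] K) : Prop :=
  (∀ h : H, A (ι' h) = ι h) ∧ A ∘L V' = V ∘L A

end Dilations

end HarnackParts

end

/-!
Testing the domination on rotated Fejér kernels and averaging over roots of unity turns it into a
domination of Toeplitz forms, `∑ ⟪x k, T_{j-k} x j⟫ ≤ c ∑ ⟪x k, T'_{j-k} x j⟫` with `T_m = T ^ m`
and `T_{-m} = T* ^ m`. On the pair `(-T' x, x)` with `‖T' x‖ = ‖x‖` the form of `T'` vanishes, which
forces `T x = T' x`. On a subspace that is invariant for `T` and `T'` and on which `T` is isometric,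
put `a = T g - T' g`: along the orbit `T ^ N a, …, T a` the form of `T` equals `N ^ 2 * ‖a‖ ^ 2`,
whereas commutativity makes the form of `T'` telescope down to `O(N)`, so `a = 0`. All inclusions
then follow from the maximality of `H_i` among the reducing, and of `N(I - S_T)` among the
invariant, isometric subspaces.
-/

namespace HarnackParts

section FejerKernel

open Polynomial

/-- The analytic polynomial whose real part on the unit circle is the Dirichlet kernel of order `l`,
rotated by `w`. -/
noncomputable def dirichletPoly (l : ℕ) (w : ℂ) : ℂ[X] :=
  1 + 2 * ∑ m ∈ Finset.range l, (C w * X) ^ (m + 1)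

/-- The analytic polynomial whose real part on the unit circle is the Fejér kernel of order `n`,
rotated by `w`. It is scaled by `n`, so that no division occurs. -/
noncomputable def fejerPoly (n : ℕ) (w : ℂ) : ℂ[X] :=
  ∑ l ∈ Finset.range n, dirichletPoly l w

theorem re_eval_dirichletPoly (l : ℕ) (w z : ℂ) :
    ((dirichletPoly l w).eval z).re = ‖∑ i ∈ Finset.range (l + 1), (w * z) ^ i‖ ^ 2 -
      ‖w * z‖ ^ 2 * ‖∑ i ∈ Finset.range l, (w * z) ^ i‖ ^ 2 := by
  have heval : (dirichletPoly l w).eval z =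
      1 + 2 * (w * z * ∑ i ∈ Finset.range l, (w * z) ^ i) := by
    simp [dirichletPoly, eval_finsetSum, Finset.mul_sum, pow_succ']
  rw [heval, geom_sum_succ, ← mul_pow, ← norm_mul]
  generalize w * z * ∑ i ∈ Finset.range l, (w * z) ^ i = y
  simp only [← Complex.normSq_eq_norm_sq, Complex.normSq_apply, Complex.add_re, Complex.add_im,
    Complex.mul_re, Complex.one_re, Complex.one_im, Complex.re_ofNat, Complex.im_ofNat]
  ring

theorem re_eval_fejerPoly (n : ℕ) (w z : ℂ) :
    ((fejerPoly n w).eval z).re = ‖∑ i ∈ Finset.range n, (w * z) ^ i‖ ^ 2 +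
      (1 - ‖w * z‖ ^ 2) * ∑ l ∈ Finset.range n, ‖∑ i ∈ Finset.range l, (w * z) ^ i‖ ^ 2 := by
  induction n with
  | zero => simp [fejerPoly]
  | succ n ih =>
    rw [fejerPoly, Finset.sum_range_succ, ← fejerPoly, eval_add, Complex.add_re, ih,
      re_eval_dirichletPoly,
      Finset.sum_range_succ fun l => ‖∑ i ∈ Finset.range l, (w * z) ^ i‖ ^ 2]
    ring

theorem re_eval_fejerPoly_nonneg (n : ℕ) {w z : ℂ} (hwz : ‖w * z‖ ≤ 1) :
    0 ≤ ((fejerPoly n w).eval z).re := by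
  have hwz' : 0 ≤ 1 - ‖w * z‖ ^ 2 := sub_nonneg.mpr (pow_le_one₀ (norm_nonneg _) hwz)
  rw [re_eval_fejerPoly]
  positivity

end FejerKernel

section ToeplitzForm

variable {H : Type u} [NormedAddCommGroup H] [InnerProductSpace ℂ H]

theorem sum_pow_zpow_of_isPrimitiveRoot {F : Type*} [Field F] {L : ℕ} {ζ : F}
    (hζ : IsPrimitiveRoot ζ L) {a : ℤ} (ha : |a| < L) :
    ∑ s ∈ Finset.range L, (ζ ^ s) ^ a = if a = 0 then (L : F) else 0 := by
  have hcomm (s : ℕ) : (ζ ^ s) ^ a = (ζ ^ a) ^ s := by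
    rw [← zpow_natCast, ← zpow_natCast, zpow_comm]
  simp_rw [hcomm]
  split_ifs with h
  · simp [h]
  · have hne : ζ ^ a ≠ 1 := fun h1 =>
      h (Int.eq_zero_of_abs_lt_dvd ((hζ.zpow_eq_one_iff_dvd a).mp h1) ha)
    rw [geom_sum_eq hne, ← hcomm, hζ.pow_eq_one, one_zpow, sub_self, zero_div]

/-- The vector-valued trigonometric polynomial with coefficients `x 0, …, x (N - 1)`, evaluated at
a point `ξ` of the unit circle. -/
noncomputable def trigPoly (x : ℕ → H) (N : ℕ) (ξ : ℂ) : H :=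
  ∑ k ∈ Finset.range N, ξ ^ k • x k

theorem inner_trigPoly (R : H →L[ℂ] H) (x : ℕ → H) (N : ℕ) {ξ : ℂ} (hξ : ‖ξ‖ = 1) :
    inner ℂ (trigPoly x N ξ) (R (trigPoly x N ξ)) =
      ∑ k ∈ Finset.range N, ∑ j ∈ Finset.range N,
        ξ ^ ((j : ℤ) - k) * inner ℂ (x k) (R (x j)) := by
  have hξ0 : ξ ≠ 0 := norm_ne_zero_iff.mp (by simp [hξ])
  have hconj : starRingEnd ℂ ξ = ξ⁻¹ := by simp [Complex.inv_eq_conj hξ]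
  simp only [trigPoly, map_sum, map_smul, sum_inner, inner_sum, inner_smul_left, inner_smul_right,
    map_pow, hconj, Finset.mul_sum]
  rw [Finset.sum_comm]
  refine Finset.sum_congr rfl fun k _ => Finset.sum_congr rfl fun j _ => ?_
  rw [zpow_sub₀ hξ0, zpow_natCast, zpow_natCast, inv_pow]
  ring

theorem sum_inner_trigPoly {L N m : ℕ} {ζ : ℂ} (hζ : IsPrimitiveRoot ζ L) (hL : L ≠ 0)
    (hm : m + N ≤ L) (R : H →L[ℂ] H) (x : ℕ → H) :
    ∑ s ∈ Finset.range L,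
        (ζ ^ s)⁻¹ ^ m * inner ℂ (trigPoly x N (ζ ^ s)) (R (trigPoly x N (ζ ^ s))) =
      L * ∑ k ∈ Finset.range (N - m), inner ℂ (x k) (R (x (k + m))) := by
  have hnorm (s : ℕ) : ‖ζ ^ s‖ = 1 := by simp [hζ.norm'_eq_one hL]
  have hshift (s : ℕ) (a : ℤ) : (ζ ^ s)⁻¹ ^ m * (ζ ^ s) ^ a = (ζ ^ s) ^ (a - m) := by
    rw [zpow_sub₀ (pow_ne_zero _ (hζ.ne_zero hL)), zpow_natCast, inv_pow]
    ring
  calc _ = ∑ k ∈ Finset.range N, ∑ j ∈ Finset.range N,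
        (∑ s ∈ Finset.range L, (ζ ^ s) ^ ((j : ℤ) - k - m)) * inner ℂ (x k) (R (x j)) := by
        simp only [inner_trigPoly R x N (hnorm _), Finset.mul_sum, Finset.sum_mul, ← mul_assoc,
          hshift]
        rw [Finset.sum_comm]
        exact Finset.sum_congr rfl fun k _ => Finset.sum_comm
    _ = ∑ k ∈ Finset.range N, ∑ j ∈ Finset.range N,
        if j = k + m then (L : ℂ) * inner ℂ (x k) (R (x j)) else 0 := by
        refine Finset.sum_congr rfl fun k hk => Finset.sum_congr rfl fun j hj => ?_
        rw [Finset.mem_range] at hk hj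
        rw [sum_pow_zpow_of_isPrimitiveRoot hζ (abs_lt.mpr ⟨by lia, by lia⟩), ite_mul, zero_mul]
        exact if_congr (by lia) rfl rfl
    _ = L * ∑ k ∈ Finset.range (N - m), inner ℂ (x k) (R (x (k + m))) := by
        simp only [Finset.sum_ite_eq', Finset.mem_range, Finset.mul_sum]
        rw [← Finset.sum_filter]
        refine Finset.sum_congr ?_ fun _ _ => rfl
        ext k
        simp only [Finset.mem_filter, Finset.mem_range]
        lia

/-- The contribution of the `m`-th diagonal to the Toeplitz form of `T` on `x 0, …, x (N - 1)`. -/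
noncomputable def correlation (T : H →L[ℂ] H) (x : ℕ → H) (N m : ℕ) : ℝ :=
  ∑ k ∈ Finset.range (N - m), (inner ℂ (x k) ((T ^ m) (x (k + m)))).re

/-- The sum of `⟪x k, T_{j-k} (x j)⟫` over `j, k < N` with `|j - k| ≤ l`, where `T_m = T ^ m` and
`T_{-m} = T* ^ m` for `m ≥ 0`. Diagonals of opposite index contribute conjugate numbers, which
gives the factor `2`. -/
noncomputable def bandedToeplitzForm (T : H →L[ℂ] H) (x : ℕ → H) (N l : ℕ) : ℝ :=
  correlation T x N 0 + 2 * ∑ m ∈ Finset.range l, correlation T x N (m + 1)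

/-- The form `∑ ⟪x k, T_{j-k} (x j)⟫` over all `j, k < N` of the Toeplitz kernel of `T`. -/
noncomputable def toeplitzForm (T : H →L[ℂ] H) (x : ℕ → H) (N : ℕ) : ℝ :=
  bandedToeplitzForm T x N N

theorem correlation_zero_right (T : H →L[ℂ] H) (x : ℕ → H) (N : ℕ) :
    correlation T x N 0 = ∑ k ∈ Finset.range N, ‖x k‖ ^ 2 :=
  Finset.sum_congr rfl fun k _ => inner_self_eq_norm_sq (𝕜 := ℂ) (x k)

theorem bandedToeplitzForm_of_le (T : H →L[ℂ] H) (x : ℕ → H) {N l : ℕ} (h : N ≤ l) :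
    bandedToeplitzForm T x N l = toeplitzForm T x N := by
  rw [toeplitzForm, bandedToeplitzForm, bandedToeplitzForm,
    ← Finset.sum_subset (Finset.range_mono h)]
  intro m _ hm
  rw [Finset.mem_range, not_lt] at hm
  simp [correlation, Nat.sub_eq_zero_of_le (hm.trans m.le_succ)]

theorem toeplitzForm_two (T : H →L[ℂ] H) (x : ℕ → H) :
    toeplitzForm T x 2 = ‖x 0‖ ^ 2 + ‖x 1‖ ^ 2 + 2 * (inner ℂ (x 0) (T (x 1))).re := by
  rw [toeplitzForm, bandedToeplitzForm, correlation_zero_right]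
  simp [correlation, Finset.sum_range_succ]

theorem inner_aeval_dirichletPoly (T : H →L[ℂ] H) (l : ℕ) (w : ℂ) (y : H) :
    inner ℂ y (Polynomial.aeval T (dirichletPoly l w) y) =
      inner ℂ y y + 2 * ∑ m ∈ Finset.range l, w ^ (m + 1) * inner ℂ y ((T ^ (m + 1)) y) := by
  have haeval : Polynomial.aeval T (dirichletPoly l w) =
      1 + (2 : ℂ) • ∑ m ∈ Finset.range l, w ^ (m + 1) • T ^ (m + 1) := by
    simp only [dirichletPoly, map_add, map_one, map_mul, map_sum, map_pow,
      Polynomial.aeval_C, Polynomial.aeval_X, ← Algebra.smul_def, smul_pow, ofNat_smul_eq_nsmul,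
      two_smul, two_mul]
  simp only [haeval, add_apply, smul_apply, sum_apply, one_apply_eq_self, inner_add_right,
    inner_smul_right, inner_sum]

theorem sum_re_inner_aeval_dirichletPoly {L N l : ℕ} {ζ : ℂ} (hζ : IsPrimitiveRoot ζ L)
    (hL : L ≠ 0) (hl : l + N ≤ L) (T : H →L[ℂ] H) (x : ℕ → H) :
    ∑ s ∈ Finset.range L, (inner ℂ (trigPoly x N (ζ ^ s))
        (Polynomial.aeval T (dirichletPoly l (ζ ^ s)⁻¹) (trigPoly x N (ζ ^ s)))).re =
      L * bandedToeplitzForm T x N l := by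
  have hcoeff (m : ℕ) (hm : m + N ≤ L) :
      (∑ s ∈ Finset.range L, (ζ ^ s)⁻¹ ^ m *
        inner ℂ (trigPoly x N (ζ ^ s)) ((T ^ m) (trigPoly x N (ζ ^ s)))).re =
          L * correlation T x N m := by
    rw [sum_inner_trigPoly hζ hL hm, ← Complex.ofReal_natCast, Complex.re_ofReal_mul,
      Complex.re_sum, correlation]
  have hzero := hcoeff 0 (by lia)
  simp only [pow_zero, one_mul, one_apply_eq_self] at hzero
  rw [← Complex.re_sum]
  simp only [inner_aeval_dirichletPoly, Finset.sum_add_distrib, ← Finset.mul_sum]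
  rw [Finset.sum_comm, Complex.add_re, hzero, ← Complex.ofReal_ofNat, Complex.re_ofReal_mul,
    Complex.re_sum, bandedToeplitzForm, mul_add, mul_left_comm,
    Finset.mul_sum _ _ (L : ℝ)]
  congr 2
  refine Finset.sum_congr rfl fun m hm => hcoeff _ ?_
  have := Finset.mem_range.mp hm
  lia

theorem sum_re_inner_aeval_fejerPoly {L N n : ℕ} {ζ : ℂ} (hζ : IsPrimitiveRoot ζ L)
    (hL : L ≠ 0) (hn : n + N ≤ L) (T : H →L[ℂ] H) (x : ℕ → H) :
    ∑ s ∈ Finset.range L, (inner ℂ (trigPoly x N (ζ ^ s))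
        (Polynomial.aeval T (fejerPoly n (ζ ^ s)⁻¹) (trigPoly x N (ζ ^ s)))).re =
      L * ∑ l ∈ Finset.range n, bandedToeplitzForm T x N l := by
  simp only [fejerPoly, map_sum, sum_apply, inner_sum, Complex.re_sum]
  rw [Finset.sum_comm, Finset.mul_sum]
  refine Finset.sum_congr rfl fun l hl => sum_re_inner_aeval_dirichletPoly hζ hL ?_ T x
  have := Finset.mem_range.mp hl
  lia

theorem tendsto_cesaro_bandedToeplitzForm (T : H →L[ℂ] H) (x : ℕ → H) (N : ℕ) :
    Tendsto (fun n : ℕ => (n : ℝ)⁻¹ * ∑ l ∈ Finset.range n, bandedToeplitzForm T x N l) atTop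
      (𝓝 (toeplitzForm T x N)) :=
  (tendsto_atTop_of_eventually_const fun _ hl => bandedToeplitzForm_of_le T x hl).cesaro

variable [CompleteSpace H]

theorem re_inner_realPart_apply (A : H →L[ℂ] H) (y : H) :
    (inner ℂ y ((ℜ A : H →L[ℂ] H) y)).re = (inner ℂ y (A y)).re := by
  rw [realPart_apply_coe, ContinuousLinearMap.star_eq_adjoint, smul_apply, add_apply,
    ← Complex.coe_smul, inner_smul_right, inner_add_right, ContinuousLinearMap.adjoint_inner_right,
    ← inner_conj_symm (A y) y, Complex.re_ofReal_mul, Complex.add_re, Complex.conj_re]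
  ring

theorem re_inner_le_of_realPart_le {A B : H →L[ℂ] H} {c : ℝ}
    (h : (ℜ A : H →L[ℂ] H) ≤ c • (ℜ B : H →L[ℂ] H)) (y : H) :
    (inner ℂ y (A y)).re ≤ c * (inner ℂ y (B y)).re := by
  have hpos := ((ContinuousLinearMap.le_def _ _).mp h).re_inner_nonneg_right y
  rwa [sub_apply, smul_apply, ← Complex.coe_smul, inner_sub_right, inner_smul_right,
    RCLike.re_eq_complex_re, Complex.sub_re, Complex.re_ofReal_mul, re_inner_realPart_apply,
    re_inner_realPart_apply, sub_nonneg] at hpos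

theorem HarnackDominated.exists_sum_bandedToeplitzForm_le {T T' : H →L[ℂ] H}
    (h : HarnackDominated T T') :
    ∃ c : ℝ, 0 ≤ c ∧ ∀ (x : ℕ → H) (N n : ℕ),
      ∑ l ∈ Finset.range n, bandedToeplitzForm T x N l ≤
        c * ∑ l ∈ Finset.range n, bandedToeplitzForm T' x N l := by
  obtain ⟨c, hc1, hc⟩ := h
  refine ⟨c, zero_le_one.trans hc1, fun x N n => ?_⟩
  have hL : n + N + 1 ≠ 0 := Nat.succ_ne_zero _
  obtain ⟨ζ, hζ⟩ : ∃ ζ : ℂ, IsPrimitiveRoot ζ (n + N + 1) := ⟨_, Complex.isPrimitiveRoot_exp _ hL⟩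
  have hpos (s : ℕ) (z : ℂ) (hz : ‖z‖ ≤ 1) : 0 ≤ ((fejerPoly n (ζ ^ s)⁻¹).eval z).re :=
    re_eval_fejerPoly_nonneg n (by simpa [hζ.norm'_eq_one hL] using hz)
  have hsum := Finset.sum_le_sum fun s (_ : s ∈ Finset.range (n + N + 1)) =>
    re_inner_le_of_realPart_le (hc _ (hpos s)) (trigPoly x N (ζ ^ s))
  rw [← Finset.mul_sum, sum_re_inner_aeval_fejerPoly hζ hL (Nat.le_succ _),
    sum_re_inner_aeval_fejerPoly hζ hL (Nat.le_succ _), mul_left_comm] at hsum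
  exact le_of_mul_le_mul_left hsum (by positivity)

theorem HarnackDominated.exists_toeplitzForm_le {T T' : H →L[ℂ] H} (h : HarnackDominated T T') :
    ∃ c : ℝ, 0 ≤ c ∧ ∀ (x : ℕ → H) (N : ℕ), toeplitzForm T x N ≤ c * toeplitzForm T' x N := by
  obtain ⟨c, hc0, hc⟩ := h.exists_sum_bandedToeplitzForm_le
  refine ⟨c, hc0, fun x N => le_of_tendsto_of_tendsto' (tendsto_cesaro_bandedToeplitzForm T x N)
    ((tendsto_cesaro_bandedToeplitzForm T' x N).const_mul c) fun n => ?_⟩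
  rw [mul_left_comm]
  exact mul_le_mul_of_nonneg_left (hc x N n) (by positivity)

end ToeplitzForm

section InvariantIsometric

variable {H : Type u} [NormedAddCommGroup H] [InnerProductSpace ℂ H]

/-- `M` is an invariant subspace for `T` on which `T` is an isometry. Neither closedness nor
invariance for `T*` is required. -/
structure IsInvariantIsometric (T : H →L[ℂ] H) (M : Submodule ℂ H) : Prop where
  map_mem : ∀ x ∈ M, T x ∈ M
  norm_map : ∀ x ∈ M, ‖T x‖ = ‖x‖

namespace IsInvariantIsometric

variable {T : H →L[ℂ] H} {M : Submodule ℂ H}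

theorem inner_map_map (hM : IsInvariantIsometric T M) {a b : H} (ha : a ∈ M) (hb : b ∈ M) :
    inner ℂ (T a) (T b) = inner ℂ a b :=
  let U : M →ₗᵢ[ℂ] H := ⟨(T : H →ₗ[ℂ] H).domRestrict M, fun x => hM.norm_map x x.2⟩
  U.inner_map_map ⟨a, ha⟩ ⟨b, hb⟩

theorem pow (hM : IsInvariantIsometric T M) (n : ℕ) : IsInvariantIsometric (T ^ n) M := by
  induction n with
  | zero => exact ⟨fun _ hx => hx, fun _ _ => rfl⟩
  | succ n ih =>
    refine ⟨fun x hx => ?_, fun x hx => ?_⟩ <;> rw [pow_succ', mul_apply_eq_comp]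
    · exact hM.map_mem _ (ih.map_mem x hx)
    · rw [hM.norm_map _ (ih.map_mem x hx), ih.norm_map x hx]

theorem congr {T' : H →L[ℂ] H} (hM : IsInvariantIsometric T' M) (h : ∀ x ∈ M, T x = T' x) :
    IsInvariantIsometric T M :=
  ⟨fun x hx => h x hx ▸ hM.map_mem x hx, fun x hx => h x hx ▸ hM.norm_map x hx⟩

end IsInvariantIsometric

theorem pow_apply_mem {R : H →L[ℂ] H} {M : Submodule ℂ H} (hR : ∀ x ∈ M, R x ∈ M) (n : ℕ) {x : H}
    (hx : x ∈ M) : (R ^ n) x ∈ M := by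
  rw [FunLike.coe_pow_eq_iterate]
  exact Set.MapsTo.iterate (s := (M : Set H)) (fun y hy => hR y hy) n hx

theorem antitone_norm_pow_apply {T : H →L[ℂ] H} (hT : ‖T‖ ≤ 1) (x : H) :
    Antitone fun n : ℕ => ‖(T ^ n) x‖ := by
  refine antitone_nat_of_succ_le fun n => ?_
  rw [pow_succ', mul_apply_eq_comp]
  simpa using T.le_of_opNorm_le hT ((T ^ n) x)

theorem norm_pow_apply_le {T : H →L[ℂ] H} (hT : ‖T‖ ≤ 1) (n : ℕ) (x : H) : ‖(T ^ n) x‖ ≤ ‖x‖ :=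
  antitone_norm_pow_apply hT x (Nat.zero_le n)

end InvariantIsometric

section Orbit

variable {H : Type u} [NormedAddCommGroup H] [InnerProductSpace ℂ H] {T R : H →L[ℂ] H}
  {M : Submodule ℂ H}

theorem correlation_orbit (hM : IsInvariantIsometric T M) (hTR : Commute T R)
    (hR : ∀ x ∈ M, R x ∈ M) {a : H} (ha : a ∈ M) (N m : ℕ) :
    correlation R (fun k => (T ^ (N - k)) a) N m =
      (N - m) • (inner ℂ ((T ^ m) a) ((R ^ m) a)).re := by
  have hterm (k : ℕ) (hk : k ∈ Finset.range (N - m)) :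
      inner ℂ ((T ^ (N - k)) a) ((R ^ m) ((T ^ (N - (k + m))) a)) =
        inner ℂ ((T ^ m) a) ((R ^ m) a) := by
    have hsplit : N - k = N - (k + m) + m := by
      have := Finset.mem_range.mp hk
      lia
    rw [← mul_apply_eq_comp (R ^ m), ← (hTR.pow_pow _ m).eq, hsplit, pow_add, mul_apply_eq_comp,
      mul_apply_eq_comp, (hM.pow _).inner_map_map ((hM.pow m).map_mem a ha)
      (pow_apply_mem hR m ha)]
  rw [correlation, Finset.sum_congr rfl fun k hk => congrArg Complex.re (hterm k hk),
    Finset.sum_const, Finset.card_range]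

theorem sum_range_sum_range {A : Type*} [AddCommMonoid A] (f : ℕ → A) (N : ℕ) :
    ∑ l ∈ Finset.range N, ∑ m ∈ Finset.range l, f m =
      ∑ m ∈ Finset.range N, (N - (m + 1)) • f m := by
  simp only [Finset.range_eq_Ico]
  rw [← Finset.sum_Ico_Ico_comm']
  simp only [Finset.sum_const, Nat.card_Ico]

theorem toeplitzForm_orbit (hM : IsInvariantIsometric T M) (hTR : Commute T R)
    (hR : ∀ x ∈ M, R x ∈ M) {a : H} (ha : a ∈ M) (N : ℕ) :
    toeplitzForm R (fun k => (T ^ (N - k)) a) N = ∑ l ∈ Finset.range N,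
      (‖a‖ ^ 2 + 2 * ∑ m ∈ Finset.range l,
        (inner ℂ ((T ^ (m + 1)) a) ((R ^ (m + 1)) a)).re) := by
  simp only [toeplitzForm, bandedToeplitzForm, correlation_orbit hM hTR hR ha,
    Finset.sum_add_distrib, ← Finset.mul_sum, sum_range_sum_range, Finset.sum_const,
    Finset.card_range, tsub_zero, pow_zero, one_apply_eq_self]
  congr 2
  exact inner_self_eq_norm_sq (𝕜 := ℂ) a

theorem toeplitzForm_orbit_self (hM : IsInvariantIsometric T M) {a : H} (ha : a ∈ M) (N : ℕ) :
    toeplitzForm T (fun k => (T ^ (N - k)) a) N = N ^ 2 * ‖a‖ ^ 2 := by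
  have hdiag (m : ℕ) : (inner ℂ ((T ^ m) a) ((T ^ m) a)).re = ‖a‖ ^ 2 := by
    rw [(hM.pow m).inner_map_map ha ha]
    exact inner_self_eq_norm_sq (𝕜 := ℂ) a
  simp only [toeplitzForm_orbit hM (Commute.refl T) hM.map_mem ha, hdiag, Finset.sum_const,
    Finset.card_range, nsmul_eq_mul]
  induction N with
  | zero => simp
  | succ N ih =>
    rw [Finset.sum_range_succ, ih]
    push_cast
    ring

/-- With `a = T g - R g` the correlations `⟪T ^ m a, R ^ m a⟫` telescope, because `T` preserves the
inner product of `T ^ m a` and `R ^ (m + 1) g`. -/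
theorem sum_re_inner_pow_sub_le (hM : IsInvariantIsometric T M) (hTR : Commute T R)
    (hR : ∀ x ∈ M, R x ∈ M) (hR1 : ‖R‖ ≤ 1) {g : H} (hg : g ∈ M) (l : ℕ) :
    ∑ m ∈ Finset.range l,
        (inner ℂ ((T ^ (m + 1)) (T g - R g)) ((R ^ (m + 1)) (T g - R g))).re ≤
      2 * (‖T g - R g‖ * ‖g‖) := by
  set a := T g - R g
  have ha : a ∈ M := M.sub_mem (hM.map_mem g hg) (hR g hg)
  let b (m : ℕ) : ℝ := (inner ℂ ((T ^ m) a) ((R ^ m) (T g))).re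
  have hb (m : ℕ) : |b m| ≤ ‖a‖ * ‖g‖ :=
    calc |b m| ≤ ‖(T ^ m) a‖ * ‖(R ^ m) (T g)‖ :=
          (Complex.abs_re_le_norm _).trans (norm_inner_le_norm _ _)
      _ ≤ ‖a‖ * ‖g‖ := by
          rw [(hM.pow m).norm_map a ha, ← hM.norm_map g hg]
          gcongr
          exact norm_pow_apply_le hR1 m _
  have hshift (m : ℕ) : inner ℂ ((T ^ m) a) ((R ^ m) (R g)) =
      inner ℂ ((T ^ (m + 1)) a) ((R ^ (m + 1)) (T g)) := by
    rw [← mul_apply_eq_comp (R ^ (m + 1)), ← (hTR.pow_right (m + 1)).eq, mul_apply_eq_comp,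
      pow_succ' T, mul_apply_eq_comp, pow_succ R, mul_apply_eq_comp,
      hM.inner_map_map ((hM.pow m).map_mem a ha) (pow_apply_mem hR m (hR g hg))]
  have hdiff (m : ℕ) : (inner ℂ ((T ^ m) a) ((R ^ m) a)).re = b m - b (m + 1) := by
    rw [show (R ^ m) a = (R ^ m) (T g) - (R ^ m) (R g) from map_sub _ _ _, inner_sub_right, hshift,
      Complex.sub_re]
  simp only [hdiff]
  rw [Finset.sum_range_sub' fun m => b (m + 1)]
  linarith [abs_le.mp (hb (0 + 1)), abs_le.mp (hb (l + 1))]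

theorem toeplitzForm_orbit_sub_le (hM : IsInvariantIsometric T M) (hTR : Commute T R)
    (hR : ∀ x ∈ M, R x ∈ M) (hR1 : ‖R‖ ≤ 1) {g : H} (hg : g ∈ M) (N : ℕ) :
    toeplitzForm R (fun k => (T ^ (N - k)) (T g - R g)) N ≤
      N * (‖T g - R g‖ ^ 2 + 4 * (‖T g - R g‖ * ‖g‖)) := by
  rw [toeplitzForm_orbit hM hTR hR (M.sub_mem (hM.map_mem g hg) (hR g hg)), ← nsmul_eq_mul]
  refine (Finset.sum_le_card_nsmul _ _ _ fun l _ => ?_).trans_eq (by rw [Finset.card_range])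
  linarith [sum_re_inner_pow_sub_le hM hTR hR hR1 hg l]

end Orbit

section Harnack

variable {H : Type u} [NormedAddCommGroup H] [InnerProductSpace ℂ H]

theorem mem_kernel_one_sub_iff {A : H →L[ℂ] H} {x : H} : x ∈ kernel (1 - A) ↔ A x = x := by
  rw [LinearMap.mem_ker, ContinuousLinearMap.coe_coe, sub_apply, one_apply_eq_self, sub_eq_zero,
    eq_comm]

variable [CompleteSpace H] {T T' : H →L[ℂ] H} {M : Submodule ℂ H}

theorem HarnackDominated.apply_eq_of_norm_eq (h : HarnackDominated T T') (hT : ‖T‖ ≤ 1) {x : H}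
    (hx : ‖T' x‖ = ‖x‖) : T x = T' x := by
  obtain ⟨c, -, hc⟩ := h.exists_toeplitzForm_le
  have hform (R : H →L[ℂ] H) : toeplitzForm R (fun k => if k = 0 then -T' x else x) 2 =
      2 * ‖x‖ ^ 2 - 2 * (inner ℂ (T' x) (R x)).re := by
    rw [toeplitzForm_two]
    simp only [if_true, one_ne_zero, if_false, norm_neg, hx, inner_neg_left, Complex.neg_re]
    ring
  have hself : (inner ℂ (T' x) (T' x)).re = ‖x‖ ^ 2 :=
    hx ▸ inner_self_eq_norm_sq (𝕜 := ℂ) (T' x)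
  have hre : ‖x‖ ^ 2 ≤ (inner ℂ (T' x) (T x)).re := by
    have hle := hc (fun k => if k = 0 then -T' x else x) 2
    rw [hform, hform, hself, sub_self, mul_zero] at hle
    linarith
  have hTx : ‖T x‖ ^ 2 ≤ ‖x‖ ^ 2 :=
    pow_le_pow_left₀ (norm_nonneg _) (by simpa using T.le_of_opNorm_le hT x) 2
  have hsub : ‖T' x - T x‖ ^ 2 ≤ 0 := by
    rw [@norm_sub_sq ℂ, hx, RCLike.re_eq_complex_re]
    linarith
  exact (sub_eq_zero.mp (norm_eq_zero.mp (sq_nonpos_iff _ |>.mp hsub))).symm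

theorem HarnackDominated.eqOn_of_isInvariantIsometric (h : HarnackDominated T T') (hT' : ‖T'‖ ≤ 1)
    (hcomm : Commute T T') (hM : IsInvariantIsometric T M) (hM' : ∀ x ∈ M, T' x ∈ M) {g : H}
    (hg : g ∈ M) : T g = T' g := by
  obtain ⟨c, hc0, hc⟩ := h.exists_toeplitzForm_le
  set a := T g - T' g
  set B := ‖a‖ ^ 2 + 4 * (‖a‖ * ‖g‖)
  have hgrowth (N : ℕ) : N * (N * ‖a‖ ^ 2) ≤ N * (c * B) :=
    calc (N : ℝ) * (N * ‖a‖ ^ 2) = toeplitzForm T (fun k => (T ^ (N - k)) a) N := by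
          rw [toeplitzForm_orbit_self hM (M.sub_mem (hM.map_mem g hg) (hM' g hg))]
          ring
      _ ≤ c * toeplitzForm T' (fun k => (T ^ (N - k)) a) N := hc _ _
      _ ≤ c * (N * B) := by
          gcongr
          exact toeplitzForm_orbit_sub_le hM hcomm hM' hT' hg N
      _ = N * (c * B) := mul_left_comm _ _ _
  by_contra hne
  have hpos : 0 < ‖a‖ ^ 2 := pow_pos (norm_pos_iff.mpr (sub_ne_zero.mpr hne)) 2
  obtain ⟨N, hN⟩ := exists_nat_gt (c * B / ‖a‖ ^ 2)
  have hcB : 0 ≤ c * B / ‖a‖ ^ 2 := by positivity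
  have hlt : c * B < N * ‖a‖ ^ 2 := (div_lt_iff₀ hpos).mp hN
  exact (mul_lt_mul_of_pos_left hlt (hcB.trans_lt hN)).not_ge (hgrowth N)

theorem adjoint_apply_apply_of_norm_eq (hT : ‖T‖ ≤ 1) {x : H} (hx : ‖T x‖ = ‖x‖) :
    (T†) (T x) = x := by
  have hT' : ‖T†‖ ≤ 1 := by rwa [LinearIsometryEquiv.norm_map]
  have hadj : ‖(T†) (T x)‖ ^ 2 ≤ ‖x‖ ^ 2 :=
    pow_le_pow_left₀ (norm_nonneg _) (by simpa [hx] using (T†).le_of_opNorm_le hT' (T x)) 2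
  have hsub : ‖(T†) (T x) - x‖ ^ 2 ≤ 0 := by
    rw [@norm_sub_sq ℂ, ContinuousLinearMap.adjoint_inner_left, inner_self_eq_norm_sq, hx]
    linarith
  exact sub_eq_zero.mp (norm_eq_zero.mp (sq_nonpos_iff _ |>.mp hsub))

theorem adjoint_pow_mul_pow_apply (T : H →L[ℂ] H) (n : ℕ) (x : H) :
    ((T†) ^ n * T ^ n) x = ((T ^ n)†) ((T ^ n) x) := by
  rw [mul_apply_eq_comp, ← ContinuousLinearMap.star_eq_adjoint,
    ← ContinuousLinearMap.star_eq_adjoint, star_pow]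

theorem tendsto_norm_pow_sq (hT : ‖T‖ ≤ 1) (x : H) :
    Tendsto (fun n : ℕ => ‖(T ^ n) x‖ ^ 2) atTop (𝓝 (inner ℂ (asymptoticLimit T x) x).re) := by
  have hinner := (isStrongLimit_asymptoticLimit hT x).inner (𝕜 := ℂ) (tendsto_const_nhds (x := x))
  refine ((Complex.continuous_re.tendsto _).comp hinner).congr fun n => ?_
  rw [Function.comp_apply, adjoint_pow_mul_pow_apply, ContinuousLinearMap.adjoint_inner_left]
  exact inner_self_eq_norm_sq (𝕜 := ℂ) _

theorem mem_kernel_one_sub_asymptoticLimit_iff (hT : ‖T‖ ≤ 1) {x : H} :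
    x ∈ kernel (1 - asymptoticLimit T) ↔ ∀ n : ℕ, ‖(T ^ n) x‖ = ‖x‖ := by
  rw [mem_kernel_one_sub_iff]
  constructor
  · intro hx n
    have hlim := tendsto_norm_pow_sq hT x
    rw [hx, ← RCLike.re_eq_complex_re, inner_self_eq_norm_sq] at hlim
    have hle : ‖x‖ ^ 2 ≤ ‖(T ^ n) x‖ ^ 2 :=
      le_of_tendsto hlim <| (eventually_ge_atTop n).mono fun m hm =>
        pow_le_pow_left₀ (norm_nonneg _) (antitone_norm_pow_apply hT x hm) 2
    exact (norm_pow_apply_le hT n x).antisymm (le_of_sq_le_sq hle (norm_nonneg _))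
  · intro hx
    refine tendsto_nhds_unique (isStrongLimit_asymptoticLimit hT x)
      (tendsto_const_nhds.congr fun n => ?_)
    have hTn : ‖T ^ n‖ ≤ 1 := ContinuousLinearMap.opNorm_le_bound _ zero_le_one fun y => by
      simpa using norm_pow_apply_le hT n y
    rw [adjoint_pow_mul_pow_apply, adjoint_apply_apply_of_norm_eq hTn (hx n)]

theorem isGreatest_kernel_one_sub_asymptoticLimit (hT : ‖T‖ ≤ 1) :
    IsGreatest {M : Submodule ℂ H | IsInvariantIsometric T M} (kernel (1 - asymptoticLimit T)) := by
  have hiff {x : H} := mem_kernel_one_sub_asymptoticLimit_iff (x := x) hT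
  have hnorm (x : H) (hx : x ∈ kernel (1 - asymptoticLimit T)) : ‖T x‖ = ‖x‖ := by
    simpa using hiff.mp hx 1
  refine ⟨⟨fun x hx => hiff.mpr fun n => ?_, hnorm⟩,
    fun M hM x hx => hiff.mpr fun n => (hM.pow n).norm_map x hx⟩
  rw [← mul_apply_eq_comp, ← pow_succ, hiff.mp hx, hnorm x hx]

theorem IsReducingIsometric.isInvariantIsometric (hM : IsReducingIsometric T M) :
    IsInvariantIsometric T M :=
  ⟨hM.1.2.1, hM.2⟩

theorem IsReducingIsometric.adjoint_apply_apply (hM : IsReducingIsometric T M) {x : H}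
    (hx : x ∈ M) : (T†) (T x) = x := by
  have hsub : (T†) (T x) - x ∈ M := M.sub_mem (hM.1.2.2 _ (hM.1.2.1 x hx)) hx
  refine sub_eq_zero.mp (inner_self_eq_zero (𝕜 := ℂ).mp ?_)
  nth_rewrite 1 [inner_sub_left]
  rw [ContinuousLinearMap.adjoint_inner_left, hM.isInvariantIsometric.inner_map_map hx hsub,
    sub_self]

/-- On `M` the adjoints agree too: `⟪z, T* x⟫ = ⟪T z, T'* T' x⟫ = ⟪T' T z, T' x⟫`, which is
symmetric in `T` and `T'` because they commute and agree on `M`. -/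
theorem IsReducingIsometric.of_commute (hM : IsReducingIsometric T' M) (hT : ‖T‖ ≤ 1)
    (hcomm : Commute T T') (heq : ∀ x ∈ M, T x = T' x) : IsReducingIsometric T M := by
  have hiso : IsInvariantIsometric T M := hM.isInvariantIsometric.congr heq
  have hadj (x : H) (hx : x ∈ M) : (T†) x = (T'†) x := by
    refine ext_inner_left ℂ fun z => ?_
    calc inner ℂ z ((T†) x) = inner ℂ (T z) ((T'†) (T' x)) := by
          rw [hM.adjoint_apply_apply hx, ContinuousLinearMap.adjoint_inner_right]
      _ = inner ℂ (T' z) ((T†) (T x)) := by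
          rw [ContinuousLinearMap.adjoint_inner_right, ContinuousLinearMap.adjoint_inner_right,
            heq x hx, ← mul_apply_eq_comp, ← mul_apply_eq_comp, hcomm.eq]
      _ = inner ℂ z ((T'†) x) := by
          rw [adjoint_apply_apply_of_norm_eq hT (hiso.norm_map x hx),
            ContinuousLinearMap.adjoint_inner_right]
  exact ⟨⟨hM.1.1, hiso.map_mem, fun x hx => hadj x hx ▸ hM.1.2.2 x hx⟩, hiso.norm_map⟩

theorem reducingIsometricPart_le_kernel (hT : ‖T‖ ≤ 1) :
    reducingIsometricPart T ≤ kernel (1 - asymptoticLimit T) :=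
  (isGreatest_kernel_one_sub_asymptoticLimit hT).2
    (isGreatest_reducingIsometricPart T).1.isInvariantIsometric

namespace HarnackDominated

theorem eqOn_reducingIsometricPart (h : HarnackDominated T T') (hT : ‖T‖ ≤ 1) {x : H}
    (hx : x ∈ reducingIsometricPart T') : T x = T' x :=
  h.apply_eq_of_norm_eq hT ((isGreatest_reducingIsometricPart T').1.2 x hx)

theorem isReducingIsometric_reducingIsometricPart (h : HarnackDominated T T') (hT : ‖T‖ ≤ 1)
    (hcomm : Commute T T') : IsReducingIsometric T (reducingIsometricPart T') :=
  (isGreatest_reducingIsometricPart T').1.of_commute hT hcomm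
    fun _ => h.eqOn_reducingIsometricPart hT

theorem reducingIsometricPart_le (h : HarnackDominated T T') (hT : ‖T‖ ≤ 1)
    (hcomm : Commute T T') : reducingIsometricPart T' ≤ reducingIsometricPart T :=
  (isGreatest_reducingIsometricPart T).2 (h.isReducingIsometric_reducingIsometricPart hT hcomm)

theorem kernel_le (h : HarnackDominated T T') (hT : ‖T‖ ≤ 1) (hT' : ‖T'‖ ≤ 1) :
    kernel (1 - asymptoticLimit T') ≤ kernel (1 - asymptoticLimit T) :=
  have hker := (isGreatest_kernel_one_sub_asymptoticLimit hT').1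
  (isGreatest_kernel_one_sub_asymptoticLimit hT).2 <|
    hker.congr fun x hx => h.apply_eq_of_norm_eq hT (hker.norm_map x hx)

theorem kernel_le_reducingIsometricPart (h : HarnackDominated T T') (hT : ‖T‖ ≤ 1)
    (hT' : ‖T'‖ ≤ 1) (hcomm : Commute T T')
    (hred : Reduces (kernel (1 - asymptoticLimit T)) T') :
    kernel (1 - asymptoticLimit T) ≤ reducingIsometricPart T' :=
  have hker := (isGreatest_kernel_one_sub_asymptoticLimit hT).1
  have heq : ∀ x ∈ kernel (1 - asymptoticLimit T), T' x = T x := fun _ hx =>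
    (h.eqOn_of_isInvariantIsometric hT' hcomm hker hred.2.1 hx).symm
  (isGreatest_reducingIsometricPart T').2 ⟨hred, (hker.congr heq).norm_map⟩

end HarnackDominated

end Harnack

end HarnackParts

open HarnackParts in
theorem mainTheorem4_general {H : Type u} [NormedAddCommGroup H] [InnerProductSpace ℂ H]
    [CompleteSpace H] (T T' : H →L[ℂ] H) (hT : ‖T‖ ≤ 1) (hT' : ‖T'‖ ≤ 1)
    (hcomm : T * T' = T' * T) (hdom : HarnackDominated T T') :
    (reducingIsometricPart T' ≤ reducingIsometricPart T ∧
      ∀ x ∈ reducingIsometricPart T', T' x = T x) ∧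
    Reduces (reducingIsometricPart T') T ∧
    (Reduces (kernel (1 - asymptoticLimit T)) T' →
      reducingIsometricPart T = reducingIsometricPart T' ∧
      reducingIsometricPart T' = kernel (1 - asymptoticLimit T') ∧
      kernel (1 - asymptoticLimit T') = kernel (1 - asymptoticLimit T)) ∧
    (HarnackEquivalent T T' → reducingIsometricPart T = reducingIsometricPart T') := by
  have hle := hdom.reducingIsometricPart_le hT hcomm
  refine ⟨⟨hle, fun _ hx => (hdom.eqOn_reducingIsometricPart hT hx).symm⟩,
    (hdom.isReducingIsometric_reducingIsometricPart hT hcomm).1, fun hred => ?_,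
    fun heqv => (heqv.2.reducingIsometricPart_le hT' hcomm.symm).antisymm hle⟩
  have hker := hdom.kernel_le hT hT'
  have hpart := hdom.kernel_le_reducingIsometricPart hT hT' hcomm hred
  exact ⟨((reducingIsometricPart_le_kernel hT).trans hpart).antisymm hle,
    (reducingIsometricPart_le_kernel hT').antisymm (hker.trans hpart),
    hker.antisymm (hpart.trans (reducingIsometricPart_le_kernel hT'))⟩

theorem mainTheorem4 {H : Type u} [NormedAddCommGroup H] [InnerProductSpace ℂ H] [CompleteSpace H]
    (T T' : H →L[ℂ] H) (hT : ‖T‖ ≤ 1) (hT' : ‖T'‖ ≤ 1) (hcomm : T * T' = T' * T)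
    (hdom : HarnackParts.HarnackDominated T T') :
    -- part (i)
    (HarnackParts.reducingIsometricPart T' ≤ HarnackParts.reducingIsometricPart T ∧
      ∀ x ∈ HarnackParts.reducingIsometricPart T', T' x = T x) ∧
    -- part (ii)
    (HarnackParts.reducingIsometricPart T ≤ HarnackParts.kernel (HarnackParts.defect T') →
      HarnackParts.Reduces (HarnackParts.reducingIsometricPart T') T) ∧
    (HarnackParts.Reduces (HarnackParts.kernel (1 - HarnackParts.asymptoticLimit T)) T' →
      HarnackParts.reducingIsometricPart T = HarnackParts.reducingIsometricPart T' ∧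
      HarnackParts.reducingIsometricPart T' =
        HarnackParts.kernel (1 - HarnackParts.asymptoticLimit T') ∧
      HarnackParts.kernel (1 - HarnackParts.asymptoticLimit T') =
        HarnackParts.kernel (1 - HarnackParts.asymptoticLimit T)) ∧
    -- part (iii)
    (∀ (K : Type v) [NormedAddCommGroup K] [InnerProductSpace ℂ K] [CompleteSpace K]
      (K' : Type w) [NormedAddCommGroup K'] [InnerProductSpace ℂ K'] [CompleteSpace K']
      (ι : H →ₗᵢ[ℂ] K) (V : K →L[ℂ] K) (ι' : H →ₗᵢ[ℂ] K') (V' : K' →L[ℂ] K') (A : K' →L[ℂ] K),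
      HarnackParts.IsMinimalIsometricDilation T ι V →
      HarnackParts.IsMinimalIsometricDilation T' ι' V' →
      HarnackParts.IsHarnackOperator ι V ι' V' A →
      Function.Injective A →
      HarnackParts.Reduces (HarnackParts.reducingIsometricPart T') T) ∧
    -- part (iv)
    (HarnackParts.HarnackEquivalent T T' →
      HarnackParts.reducingIsometricPart T = HarnackParts.reducingIsometricPart T') := by
  obtain ⟨hpart, hred, hker, heqv⟩ := mainTheorem4_general T T' hT hT' hcomm hdom
  exact ⟨hpart, fun _ => hred, hker, by intros; exact hred, heqv⟩
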